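/- For complex numbers $\Upsilon,\varkappa,\varrho,\gamma_1,\gamma_2,\gamma_3,\gamma_4$ with positive real parts and $x,y\in\mathbb C$ let $$E_{\varkappa,\varrho,\Upsilon}^{(\gamma_1;\gamma_2;\gamma_3;\gamma_4)}(x,y)=\sum_{s=0}^\infty\sum_{r=0}^\infty\frac{(\gamma_1)_{2s}(\gamma_2)_{s+r}\,x^s\,y^{\Upsilon r}}{(\gamma_3)_s(\gamma_4)_s\,\Gamma(\varkappa+s)\,\Gamma(\varrho+\Upsilon r)\,r!\,s!},$$ where $(a)_n=a(a+1)\cdots(a+n-1)$ and complex powers are principal values (with $0^0=1$ and $0^{z}=0$ for $z\neq 0$). Theorem. Let $\varkappa,\varrho,\sigma,\eta,\Upsilon,\gamma_1,\gamma_2,\mu_1,\mu_2\in\mathbb C$ have positive real parts, let $\varpi_1,\varpi_2\in\mathbb C$ and let $X,Y>0$ be real. Then $$\int_0^X\!\!\int_0^Y (X-t)^{\varkappa-1}(Y-\omega)^{\varrho-1}E_{\varkappa,\varrho,\Upsilon}^{(\gamma_1;\gamma_2;\frac{\gamma_1+1}{2};\gamma_2)}\big(\varpi_1(X-t),\varpi_2(Y-\omega)\big)\,t^{\sigma-1}\omega^{\eta-1}E_{\sigma,\eta,\Upsilon}^{(\mu_1;\mu_2;\frac{\mu_1+1}{2};\mu_2)}(\varpi_1t,\varpi_2\omega)\,d\omega\,dt$$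 $$=X^{\varkappa+\sigma-1}Y^{\varrho+\eta-1}E_{\varkappa+\sigma,\varrho+\eta,\Upsilon}^{(\gamma_1+\mu_1;\gamma_2+\mu_2;\frac{\gamma_1+\mu_1+1}{2};\gamma_2+\mu_2)}(\varpi_1X,\varpi_2Y).$$ Here the double series defining the three functions $E$ converge absolutely at all $(x,y)\in\mathbb C^2$, and the integrand is absolutely integrable on $(0,X)\times(0,Y)$. -/

import Mathlib

/-- The general term
`(γ₁)_{2s} (γ₂)_{s+r} x^s y^{Υ r} / ((γ₃)_s (γ₄)_s Γ(κ + s) Γ(ρ + Υ r) r! s!)`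
of the modified bivariate Hermite-Konhauser Mittag-Leffler series. Here `(a)_n` is the rising
factorial and `y ^ (Υ r)` is the principal branch of the complex power. -/
noncomputable def hkMittagLefflerTerm
    (κ ρ Υ γ₁ γ₂ γ₃ γ₄ x y : ℂ) (s r : ℕ) : ℂ :=
  ((ascPochhammer ℂ (2 * s)).eval γ₁ * (ascPochhammer ℂ (s + r)).eval γ₂
      * x ^ s * y ^ (Υ * (r : ℂ)))
    / ((ascPochhammer ℂ s).eval γ₃ * (ascPochhammer ℂ s).eval γ₄
      * Complex.Gamma (κ + (s : ℂ)) * Complex.Gamma (ρ + Υ * (r : ℂ))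
      * (r.factorial : ℂ) * (s.factorial : ℂ))

/-- The modified bivariate Hermite-Konhauser Mittag-Leffler function
`E_{κ,ρ,Υ}^{(γ₁;γ₂;γ₃;γ₄)}(x, y)`. -/
noncomputable def hkMittagLeffler (κ ρ Υ γ₁ γ₂ γ₃ γ₄ x y : ℂ) : ℂ :=
  ∑' s : ℕ, ∑' r : ℕ, hkMittagLefflerTerm κ ρ Υ γ₁ γ₂ γ₃ γ₄ x y s r

/-- The function `X^{κ-1} Y^{ρ-1} E_{κ,ρ,Υ}^{(γ₁;γ₂;(γ₁+1)/2;γ₂)}(ϖ₁ X, ϖ₂ Y)` of two real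
variables (of interest for `X, Y > 0`). -/
noncomputable def hkKernel (κ ρ Υ γ₁ γ₂ ϖ₁ ϖ₂ : ℂ) (X Y : ℝ) : ℂ :=
  (X : ℂ) ^ (κ - 1) * (Y : ℂ) ^ (ρ - 1)
    * hkMittagLeffler κ ρ Υ γ₁ γ₂ ((γ₁ + 1) / 2) γ₂ (ϖ₁ * (X : ℂ)) (ϖ₂ * (Y : ℂ))

/-! The special lower parameters make the series a double convolution semigroup. Since `(γ₁)_{2s} =
4^s (γ₁/2)_s ((γ₁+1)/2)_s` and `(γ₂)_{s+r} = (γ₂)_s (γ₂+s)_r`, they cancel, and the kernel is the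
sum over `s, r` of `hkCoeff γ₁ γ₂ s r * ϖ₁^s (ϖ₂^Υ)^r` times Riemann-Liouville kernels of orders
`κ+s` in `X` and `ρ+Υr` in `Y`.

Under convolution the orders of these kernels add, by the beta integral (`integral_rlKernel_mul`).
Under the Cauchy product the parameters of the coefficients add, by Chu-Vandermonde
(`sum_antidiagonal_hkCoeff`). Multiplying two such series, integrating termwise and regrouping along
antidiagonals gives the formula.

Convergence: the coefficients grow at most geometrically, while `1/Γ` decays faster than
geometrically (`summable_pow_div_norm_Gamma`). Termwise integration is dominated by the term norms
at `(ϖ₁X, ϖ₂Y)` times an integrable power weight. -/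

open Finset Complex MeasureTheory Filter Topology

/-! ### Rising factorials and Chu-Vandermonde -/

/-- The rising binomial coefficient `(a)_n / n!`. -/
noncomputable def risingBinom (a : ℂ) (n : ℕ) : ℂ :=
  (ascPochhammer ℂ n).eval a / (n.factorial : ℂ)

lemma risingBinom_zero (a : ℂ) : risingBinom a 0 = 1 := by simp [risingBinom]

lemma succ_mul_risingBinom_succ (a : ℂ) (n : ℕ) :
    ((n : ℂ) + 1) * risingBinom a (n + 1) = (a + n) * risingBinom a n := by
  have h : (n.factorial : ℂ) ≠ 0 := Nat.cast_ne_zero.2 n.factorial_ne_zero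
  have h' : (n : ℂ) + 1 ≠ 0 := Nat.cast_add_one_ne_zero n
  simp only [risingBinom, ascPochhammer_succ_eval, Nat.factorial_succ]
  push_cast
  field_simp

/-- The Chu-Vandermonde identity for rising binomial coefficients. -/
lemma risingBinom_add (a b : ℂ) (n : ℕ) :
    ∑ p ∈ antidiagonal n, risingBinom a p.1 * risingBinom b p.2 = risingBinom (a + b) n := by
  induction n with
  | zero => simp [risingBinom_zero]
  | succ n ih =>
    have h' : (n : ℂ) + 1 ≠ 0 := Nat.cast_add_one_ne_zero n
    -- On the antidiagonal `n + 1 = p.1 + p.2`; each summand is absorbed by the recursion for its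
    -- own factor, and the multipliers `a + p.1` and `b + p.2` then add up to `a + b + n`.
    refine mul_left_cancel₀ h' ?_
    rw [succ_mul_risingBinom_succ, ← ih, mul_sum, mul_sum]
    have h1 : ∑ p ∈ antidiagonal (n + 1), (p.1 : ℂ) * (risingBinom a p.1 * risingBinom b p.2)
        = ∑ p ∈ antidiagonal n, (a + p.1) * (risingBinom a p.1 * risingBinom b p.2) := by
      rw [Nat.sum_antidiagonal_succ]
      simp only [Nat.cast_zero, zero_mul, zero_add]
      refine sum_congr rfl fun p _ => ?_
      push_cast
      rw [← mul_assoc, succ_mul_risingBinom_succ, mul_assoc]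
    have h2 : ∑ p ∈ antidiagonal (n + 1), (p.2 : ℂ) * (risingBinom a p.1 * risingBinom b p.2)
        = ∑ p ∈ antidiagonal n, (b + p.2) * (risingBinom a p.1 * risingBinom b p.2) := by
      rw [Nat.sum_antidiagonal_succ']
      simp only [Nat.cast_zero, zero_mul, zero_add]
      refine sum_congr rfl fun p _ => ?_
      push_cast
      rw [mul_left_comm, succ_mul_risingBinom_succ]
      ring
    calc ∑ p ∈ antidiagonal (n + 1), ((n : ℂ) + 1) * (risingBinom a p.1 * risingBinom b p.2)
        = ∑ p ∈ antidiagonal (n + 1), (p.1 : ℂ) * (risingBinom a p.1 * risingBinom b p.2)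
          + ∑ p ∈ antidiagonal (n + 1), (p.2 : ℂ) * (risingBinom a p.1 * risingBinom b p.2) := by
          rw [← sum_add_distrib]
          refine sum_congr rfl fun p hp => ?_
          rw [← add_mul]
          congr 1
          exact_mod_cast (mem_antidiagonal.1 hp).symm
      _ = _ := by
          rw [h1, h2, ← sum_add_distrib]
          refine sum_congr rfl fun p hp => ?_
          rw [← add_mul, ← mem_antidiagonal.1 hp]
          congr 1
          push_cast
          ring

lemma norm_ascPochhammer_eval_le (a : ℂ) (N : ℕ) (ha : ‖a‖ ≤ N) (n : ℕ) :
    ‖(ascPochhammer ℂ n).eval a‖ ≤ ((N + 1).ascFactorial n : ℝ) := by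
  induction n with
  | zero => simp
  | succ n ih =>
    rw [ascPochhammer_succ_eval, norm_mul, Nat.ascFactorial_succ, mul_comm]
    push_cast
    gcongr
    calc ‖a + n‖ ≤ ‖a‖ + ‖(n : ℂ)‖ := norm_add_le _ _
      _ ≤ N + 1 + n := by rw [Complex.norm_natCast]; linarith

/-- Replacing `a` by the integer `N + 1` turns the quotient into the binomial coefficient of `N + n`
over `n`. -/
lemma norm_risingBinom_le (a : ℂ) (N : ℕ) (ha : ‖a‖ ≤ N) (n : ℕ) :
    ‖risingBinom a n‖ ≤ 2 ^ (N + n) := by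
  have h : (0 : ℝ) < n.factorial := Nat.cast_pos.2 n.factorial_pos
  rw [risingBinom, norm_div, Complex.norm_natCast, div_le_iff₀ h]
  refine (norm_ascPochhammer_eval_le a N ha n).trans ?_
  rw [Nat.ascFactorial_eq_factorial_mul_choose, mul_comm]
  exact_mod_cast Nat.mul_le_mul_right _ (Nat.choose_le_two_pow (N + n) n)

lemma ascPochhammer_eval_add (a : ℂ) (m n : ℕ) :
    (ascPochhammer ℂ (m + n)).eval a
      = (ascPochhammer ℂ m).eval a * (ascPochhammer ℂ n).eval (a + m) := by
  rw [← ascPochhammer_mul]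
  simp

/-- The duplication formula for the rising factorial. -/
lemma ascPochhammer_eval_two_mul (a : ℂ) (n : ℕ) :
    (ascPochhammer ℂ (2 * n)).eval a
      = 4 ^ n * (ascPochhammer ℂ n).eval (a / 2) * (ascPochhammer ℂ n).eval ((a + 1) / 2) := by
  induction n with
  | zero => simp
  | succ n ih =>
    rw [show 2 * (n + 1) = 2 * n + 1 + 1 by ring, ascPochhammer_succ_eval,
      ascPochhammer_succ_eval, ih, ascPochhammer_succ_eval, ascPochhammer_succ_eval]
    push_cast
    ring

lemma ascPochhammer_eval_ne_zero {a : ℂ} (ha : 0 < a.re) (n : ℕ) :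
    (ascPochhammer ℂ n).eval a ≠ 0 := by
  induction n with
  | zero => simp
  | succ n ih =>
    rw [ascPochhammer_succ_eval]
    refine mul_ne_zero ih fun h => ?_
    have := congrArg Complex.re h
    simp only [add_re, natCast_re, zero_re] at this
    have : (0 : ℝ) ≤ n := n.cast_nonneg
    linarith

/-! ### Coefficients of the series -/

/-- The part of the general term of the series that depends on the upper parameters only. -/
noncomputable def hkCoeff (γ₁ γ₂ : ℂ) (s r : ℕ) : ℂ :=
  4 ^ s * risingBinom (γ₁ / 2) s * risingBinom (γ₂ + s) r

lemma hkMittagLefflerTerm_eq (κ ρ Υ : ℂ) {γ₁ γ₂ : ℂ} (h₁ : 0 < γ₁.re) (h₂ : 0 < γ₂.re)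
    (x y : ℂ) (s r : ℕ) :
    hkMittagLefflerTerm κ ρ Υ γ₁ γ₂ ((γ₁ + 1) / 2) γ₂ x y s r
      = hkCoeff γ₁ γ₂ s r * (x ^ s / Gamma (κ + s)) * ((y ^ Υ) ^ r / Gamma (ρ + Υ * r)) := by
  have h3 : (ascPochhammer ℂ s).eval ((γ₁ + 1) / 2) ≠ 0 := by
    refine ascPochhammer_eval_ne_zero ?_ s
    have : ((γ₁ + 1) / 2).re = (γ₁.re + 1) / 2 := by simp
    rw [this]
    linarith
  have h4 := ascPochhammer_eval_ne_zero h₂ s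
  rw [hkMittagLefflerTerm, ascPochhammer_eval_two_mul, ascPochhammer_eval_add, cpow_mul_nat,
    hkCoeff, risingBinom, risingBinom]
  generalize (ascPochhammer ℂ s).eval ((γ₁ + 1) / 2) = A at *
  generalize (ascPochhammer ℂ s).eval γ₂ = B at *
  generalize (ascPochhammer ℂ s).eval (γ₁ / 2) = C
  generalize (ascPochhammer ℂ r).eval (γ₂ + s) = D
  simp only [div_eq_mul_inv, mul_inv]
  -- The two sides differ only by the factor `A * A⁻¹ * B * B⁻¹ = 1`.
  linear_combination (4 ^ s * C * D * x ^ s * (y ^ Υ) ^ r * (Gamma (κ + s))⁻¹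
    * (Gamma (ρ + Υ * r))⁻¹ * (r.factorial : ℂ)⁻¹ * (s.factorial : ℂ)⁻¹)
    * (A * A⁻¹ * mul_inv_cancel₀ h4 + mul_inv_cancel₀ h3)

/-- The coefficients form a convolution semigroup in the upper parameters. -/
lemma sum_antidiagonal_hkCoeff (γ₁ γ₂ μ₁ μ₂ : ℂ) (n m : ℕ) :
    ∑ i ∈ antidiagonal n, ∑ j ∈ antidiagonal m, hkCoeff γ₁ γ₂ i.1 j.1 * hkCoeff μ₁ μ₂ i.2 j.2
      = hkCoeff (γ₁ + μ₁) (γ₂ + μ₂) n m := by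
  rw [hkCoeff, add_div, ← risingBinom_add (γ₁ / 2), mul_sum, sum_mul]
  refine sum_congr rfl fun i hi => ?_
  -- The shift by `s` is shared between the two factors, so Chu-Vandermonde applies in `r` for each
  -- fixed splitting of `s`.
  rw [← mem_antidiagonal.1 hi, show γ₂ + μ₂ + ((i.1 + i.2 : ℕ) : ℂ) = (γ₂ + i.1) + (μ₂ + i.2) by
    push_cast; ring, ← risingBinom_add, mul_sum]
  refine sum_congr rfl fun j _ => ?_
  rw [hkCoeff, hkCoeff, pow_add]
  ring

/-- The base 16 is `4 * 2 * 2`: the explicit power, the first binomial, and the shift by `s` in the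
second. -/
lemma norm_hkCoeff_le (γ₁ γ₂ : ℂ) :
    ∃ C : ℝ, 0 ≤ C ∧ ∀ s r : ℕ, ‖hkCoeff γ₁ γ₂ s r‖ ≤ C * (16 ^ s * 2 ^ r) := by
  obtain ⟨N, hN⟩ := exists_nat_ge ‖γ₁ / 2‖
  obtain ⟨M, hM⟩ := exists_nat_ge ‖γ₂‖
  refine ⟨2 ^ N * 2 ^ M, by positivity, fun s r => ?_⟩
  have h1 := norm_risingBinom_le _ N hN s
  have h2 := norm_risingBinom_le (γ₂ + s) (M + s) (by
    push_cast
    exact (norm_add_le _ _).trans (by rw [Complex.norm_natCast]; linarith)) r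
  rw [hkCoeff, norm_mul, norm_mul, norm_pow]
  calc ‖(4 : ℂ)‖ ^ s * ‖risingBinom (γ₁ / 2) s‖ * ‖risingBinom (γ₂ + s) r‖
      ≤ 4 ^ s * 2 ^ (N + s) * 2 ^ (M + s + r) := by
        gcongr
        simp
    _ = _ := by
        rw [show (16 : ℝ) = 4 * 2 * 2 by norm_num]
        simp only [pow_add, mul_pow]
        ring

/-! ### Beta integrals and decay of the reciprocal Gamma function -/

lemma norm_betaIntegral_le {u v : ℂ} :
    ‖betaIntegral u v‖ ≤ ∫ x in Set.Ioo (0 : ℝ) 1, x ^ (u.re - 1) * (1 - x) ^ (v.re - 1) := by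
  rw [betaIntegral, intervalIntegral.integral_of_le zero_le_one, integral_Ioc_eq_integral_Ioo]
  refine (norm_integral_le_integral_norm _).trans_eq ?_
  refine setIntegral_congr_fun measurableSet_Ioo fun x hx => ?_
  have h1 : (1 : ℂ) - x = ((1 - x : ℝ) : ℂ) := by push_cast; rfl
  simp only [norm_mul]
  rw [h1, norm_cpow_eq_rpow_re_of_pos hx.1, norm_cpow_eq_rpow_re_of_pos (sub_pos.2 hx.2)]
  simp

lemma integrableOn_beta {a b : ℝ} (ha : 0 < a) (hb : 0 < b) :
    IntegrableOn (fun x : ℝ => x ^ (a - 1) * (1 - x) ^ (b - 1)) (Set.Ioo 0 1) := by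
  have h := (betaIntegral_convergent (u := a) (v := b) (by simpa) (by simpa)).norm
  rw [intervalIntegrable_iff_integrableOn_Ioo_of_le zero_le_one] at h
  refine h.congr_fun (fun x hx => ?_) measurableSet_Ioo
  have h1 : (1 : ℂ) - x = ((1 - x : ℝ) : ℂ) := by push_cast; rfl
  simp only [norm_mul]
  rw [h1, norm_cpow_eq_rpow_re_of_pos hx.1, norm_cpow_eq_rpow_re_of_pos (sub_pos.2 hx.2)]
  simp

lemma tendsto_integral_beta_atTop {a b c : ℝ} (ha : 0 < a) (hb : 0 < b) (hc : 0 < c) :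
    Tendsto (fun n : ℕ => ∫ x in Set.Ioo (0 : ℝ) 1, x ^ (a + c * n - 1) * (1 - x) ^ (b - 1))
      atTop (𝓝 0) := by
  have key : Tendsto
      (fun n : ℕ => ∫ x in Set.Ioo (0 : ℝ) 1, x ^ (a + c * n - 1) * (1 - x) ^ (b - 1))
      atTop (𝓝 (∫ _ in Set.Ioo (0 : ℝ) 1, (0 : ℝ))) := by
    refine tendsto_integral_of_dominated_convergence
      (fun x : ℝ => x ^ (a - 1) * (1 - x) ^ (b - 1)) (fun n => ?_) (integrableOn_beta ha hb)
      (fun n => ?_) ?_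
    · exact Measurable.aestronglyMeasurable (by fun_prop)
    · refine (ae_restrict_iff' measurableSet_Ioo).2 (Eventually.of_forall fun x hx => ?_)
      have h0 : 0 < 1 - x := sub_pos.2 hx.2
      have h1 := hx.1
      rw [Real.norm_of_nonneg (by positivity)]
      gcongr ?_ * _
      refine Real.rpow_le_rpow_of_exponent_ge hx.1 hx.2.le ?_
      have : 0 ≤ c * n := by positivity
      linarith
    · refine (ae_restrict_iff' measurableSet_Ioo).2 (Eventually.of_forall fun x hx => ?_)
      have h : ∀ n : ℕ, x ^ (a + c * n - 1) * (1 - x) ^ (b - 1)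
          = (x ^ c) ^ n * (x ^ (a - 1) * (1 - x) ^ (b - 1)) := fun n => by
        rw [show a + c * n - 1 = c * n + (a - 1) by ring, Real.rpow_add hx.1,
          Real.rpow_mul_natCast hx.1.le, mul_assoc]
      simp only [h]
      rw [← zero_mul (x ^ (a - 1) * (1 - x) ^ (b - 1))]
      exact (tendsto_pow_atTop_nhds_zero_of_lt_one (Real.rpow_nonneg hx.1.le c)
        (Real.rpow_lt_one hx.1.le hx.2 hc)).mul_const _
  simpa using key

/-- The reciprocal Gamma function decays faster than any geometric sequence along an arithmetic
progression in the right half-plane. -/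
lemma summable_pow_div_norm_Gamma {a b : ℂ} (ha : 0 < a.re) (hb : 0 < b.re) (A : ℝ) :
    Summable fun n : ℕ => A ^ n / ‖Gamma (a + b * n)‖ := by
  have hre : ∀ n : ℕ, (a + b * n).re = a.re + b.re * n := fun n => by simp
  have hpos : ∀ n : ℕ, 0 < (a + b * n).re := fun n => by rw [hre]; positivity
  have hb0 : 0 < ‖Gamma b‖ := norm_pos_iff.2 (Gamma_ne_zero_of_re_pos hb)
  refine summable_of_ratio_norm_eventually_le (r := 1 / 2) (by norm_num) ?_
  have ht := (tendsto_integral_beta_atTop ha hb hb).const_mul (|A| / ‖Gamma b‖)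
  rw [mul_zero] at ht
  filter_upwards [ht.eventually_le_const (by norm_num : (0 : ℝ) < 1 / 2)] with n hn
  have h0 : 0 < ‖Gamma (a + b * n)‖ := norm_pos_iff.2 (Gamma_ne_zero_of_re_pos (hpos n))
  have h1 : 0 < ‖Gamma (a + b * (n + 1 : ℕ))‖ :=
    norm_pos_iff.2 (Gamma_ne_zero_of_re_pos (hpos (n + 1)))
  -- The ratio of consecutive Gamma values is a beta integral divided by `Γ(b)`, and that integral
  -- tends to 0; this drives the ratio test.
  have hG := congrArg norm (Gamma_mul_Gamma_eq_betaIntegral (hpos n) hb)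
  rw [norm_mul, norm_mul, show a + b * n + b = a + b * (n + 1 : ℕ) by push_cast; ring] at hG
  have hB := norm_betaIntegral_le (u := a + b * n) (v := b)
  rw [hre] at hB
  set I := ∫ x in Set.Ioo (0 : ℝ) 1, x ^ (a.re + b.re * n - 1) * (1 - x) ^ (b.re - 1)
  have hle : ‖Gamma (a + b * n)‖ * ‖Gamma b‖ ≤ ‖Gamma (a + b * (n + 1 : ℕ))‖ * I := by
    rw [hG]; gcongr
  rw [norm_div, norm_div, norm_norm, norm_norm, norm_pow, norm_pow, Real.norm_eq_abs,
    div_le_iff₀ h1]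
  have hAI : |A| * I ≤ 1 / 2 * ‖Gamma b‖ := by
    rwa [div_mul_eq_mul_div, div_le_iff₀ hb0] at hn
  have h3 : |A| * ‖Gamma (a + b * n)‖ ≤ 1 / 2 * ‖Gamma (a + b * (n + 1 : ℕ))‖ := by
    refine le_of_mul_le_mul_right ?_ hb0
    calc |A| * ‖Gamma (a + b * n)‖ * ‖Gamma b‖ = |A| * (‖Gamma (a + b * n)‖ * ‖Gamma b‖) := by ring
      _ ≤ |A| * (‖Gamma (a + b * (n + 1 : ℕ))‖ * I) := by gcongr
      _ = ‖Gamma (a + b * (n + 1 : ℕ))‖ * (|A| * I) := by ring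
      _ ≤ ‖Gamma (a + b * (n + 1 : ℕ))‖ * (1 / 2 * ‖Gamma b‖) := by gcongr
      _ = _ := by ring
  calc |A| ^ (n + 1) = |A| ^ n * (|A| * ‖Gamma (a + b * n)‖) / ‖Gamma (a + b * n)‖ := by
        field_simp; ring
    _ ≤ |A| ^ n * (1 / 2 * ‖Gamma (a + b * (n + 1 : ℕ))‖) / ‖Gamma (a + b * n)‖ := by gcongr
    _ = _ := by ring

lemma summable_hkMittagLefflerTerm {κ ρ Υ γ₁ γ₂ : ℂ} (hκ : 0 < κ.re) (hρ : 0 < ρ.re)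
    (hΥ : 0 < Υ.re) (h₁ : 0 < γ₁.re) (h₂ : 0 < γ₂.re) (x y : ℂ) :
    Summable fun p : ℕ × ℕ =>
      hkMittagLefflerTerm κ ρ Υ γ₁ γ₂ ((γ₁ + 1) / 2) γ₂ x y p.1 p.2 := by
  obtain ⟨C, hC, hle⟩ := norm_hkCoeff_le γ₁ γ₂
  have hs := summable_pow_div_norm_Gamma hκ (b := 1) (by simp) (16 * ‖x‖)
  have hr := summable_pow_div_norm_Gamma hρ hΥ (2 * ‖y ^ Υ‖)
  simp only [one_mul] at hs
  refine Summable.of_norm_bounded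
    ((hs.mul_of_nonneg hr (fun n => by positivity) (fun n => by positivity)).mul_left C)
    fun p => ?_
  rw [hkMittagLefflerTerm_eq κ ρ Υ h₁ h₂]
  simp only [norm_mul, norm_div, norm_pow, mul_pow]
  calc ‖hkCoeff γ₁ γ₂ p.1 p.2‖ * (‖x‖ ^ p.1 / ‖Gamma (κ + p.1)‖)
        * (‖y ^ Υ‖ ^ p.2 / ‖Gamma (ρ + Υ * p.2)‖)
      ≤ C * (16 ^ p.1 * 2 ^ p.2) * (‖x‖ ^ p.1 / ‖Gamma (κ + p.1)‖)
        * (‖y ^ Υ‖ ^ p.2 / ‖Gamma (ρ + Υ * p.2)‖) := by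
        gcongr
        exact hle _ _
    _ = _ := by ring

/-! ### Complex powers and Riemann-Liouville kernels -/

lemma mul_ofReal_cpow (c z : ℂ) {t : ℝ} (ht : 0 < t) :
    (c * (t : ℂ)) ^ z = c ^ z * (t : ℂ) ^ z := by
  rcases eq_or_ne c 0 with rfl | hc
  · rcases eq_or_ne z 0 with rfl | hz
    · simp
    · simp [zero_cpow hz]
  · have ht' : (t : ℂ) ≠ 0 := ofReal_ne_zero.2 ht.ne'
    rw [cpow_def_of_ne_zero (mul_ne_zero hc ht'), cpow_def_of_ne_zero hc,
      cpow_def_of_ne_zero ht', log_mul_ofReal t ht c hc, ← exp_add, ofReal_log ht.le]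
    ring_nf

/-- The normalized power `x ^ (a - 1) / Γ(a)`, the kernel of the Riemann-Liouville integral. -/
noncomputable def rlKernel (a : ℂ) (x : ℝ) : ℂ := (x : ℂ) ^ (a - 1) / Gamma a

lemma rlKernel_add (a b : ℂ) {x : ℝ} (hx : 0 < x) :
    rlKernel (a + b) x = (x : ℂ) ^ (a - 1) * ((x : ℂ) ^ b / Gamma (a + b)) := by
  rw [rlKernel, show a + b - 1 = a - 1 + b by ring, cpow_add _ _ (ofReal_ne_zero.2 hx.ne'),
    mul_div_assoc]

lemma integral_rlKernel_mul {a b : ℂ} (ha : 0 < a.re) (hb : 0 < b.re) {X : ℝ} (hX : 0 < X) :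
    ∫ t in Set.Ioo 0 X, rlKernel a (X - t) * rlKernel b t = rlKernel (a + b) X := by
  have hab : Gamma (a + b) ≠ 0 := Gamma_ne_zero_of_re_pos (by rw [add_re]; positivity)
  have ha' := Gamma_ne_zero_of_re_pos ha
  have hb' := Gamma_ne_zero_of_re_pos hb
  have h := betaIntegral_scaled b a hX
  rw [intervalIntegral.integral_of_le hX.le, integral_Ioc_eq_integral_Ioo] at h
  have h2 := Gamma_mul_Gamma_eq_betaIntegral hb ha
  rw [add_comm b a] at h h2
  calc ∫ t in Set.Ioo 0 X, rlKernel a (X - t) * rlKernel b t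
      = ∫ t in Set.Ioo 0 X, (t : ℂ) ^ (b - 1) * ((X : ℂ) - t) ^ (a - 1)
          * (Gamma a * Gamma b)⁻¹ := by
        refine integral_congr_ae (Eventually.of_forall fun t => ?_)
        simp only [rlKernel]
        push_cast
        field_simp
    _ = _ := by
        rw [integral_mul_const, h, rlKernel, mul_comm (Gamma a), h2]
        have hB : betaIntegral b a ≠ 0 := fun h0 => by
          rw [h0, mul_zero] at h2
          exact mul_ne_zero hb' ha' h2
        field_simp

lemma integrableOn_rlKernel_mul {a b : ℂ} (ha : 0 < a.re) (hb : 0 < b.re) {X : ℝ} (hX : 0 < X) :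
    IntegrableOn (fun t : ℝ => ((X - t : ℝ) : ℂ) ^ (a - 1) * (t : ℂ) ^ (b - 1))
      (Set.Ioo 0 X) := by
  -- Rescaling from the unit interval; the powers of `X` and `X⁻¹` cancel by `h4`.
  have h := (betaIntegral_convergent hb ha).comp_mul_left (c := X⁻¹)
  have hX' : (X : ℂ) ≠ 0 := ofReal_ne_zero.2 hX.ne'
  simp only [zero_div, one_div, inv_inv] at h
  rw [intervalIntegrable_iff_integrableOn_Ioo_of_le hX.le] at h
  refine IntegrableOn.congr_fun (h.const_mul ((X : ℂ) ^ (a - 1) * (X : ℂ) ^ (b - 1)))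
    (fun t ht => ?_) measurableSet_Ioo
  have h1 : (1 : ℂ) - ((X⁻¹ * t : ℝ) : ℂ) = ((X⁻¹ * (X - t) : ℝ) : ℂ) := by
    push_cast
    field_simp
  have h2 := mul_cpow_ofReal_nonneg (r := b - 1) (inv_nonneg.2 hX.le) ht.1.le
  have h3 := mul_cpow_ofReal_nonneg (r := a - 1) (inv_nonneg.2 hX.le) (sub_pos.2 ht.2).le
  have h4 : ∀ z : ℂ, (X : ℂ) ^ z * ((X⁻¹ : ℝ) : ℂ) ^ z = 1 := fun z => by
    rw [← mul_cpow_ofReal_nonneg hX.le (inv_nonneg.2 hX.le), ← ofReal_mul,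
      mul_inv_cancel₀ hX.ne', ofReal_one, one_cpow]
  rw [h1, ofReal_mul, ofReal_mul, h2, h3]
  linear_combination ((X : ℂ) ^ (b - 1) * ((X⁻¹ : ℝ) : ℂ) ^ (b - 1)
      * (((X - t : ℝ) : ℂ) ^ (a - 1) * (t : ℂ) ^ (b - 1))) * h4 (a - 1)
    + (((X - t : ℝ) : ℂ) ^ (a - 1) * (t : ℂ) ^ (b - 1)) * h4 (b - 1)

/-- A positive factor splits off the principal power, so `y` enters the norm only through `y ^
Υ.re`, which increases as `Υ.re > 0`. This supplies a dominating sequence independent of the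
integration point. -/
lemma norm_hkMittagLefflerTerm_mono (κ ρ γ₁ γ₂ γ₃ γ₄ ϖ₁ ϖ₂ : ℂ) {Υ : ℂ} (hΥ : 0 < Υ.re)
    {x y X Y : ℝ} (hx : 0 < x) (hxX : x ≤ X) (hy : 0 < y) (hyY : y ≤ Y) (s r : ℕ) :
    ‖hkMittagLefflerTerm κ ρ Υ γ₁ γ₂ γ₃ γ₄ (ϖ₁ * x) (ϖ₂ * y) s r‖
      ≤ ‖hkMittagLefflerTerm κ ρ Υ γ₁ γ₂ γ₃ γ₄ (ϖ₁ * X) (ϖ₂ * Y) s r‖ := by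
  have hX := hx.trans_le hxX
  have hY := hy.trans_le hyY
  simp only [hkMittagLefflerTerm, cpow_mul_nat, mul_ofReal_cpow _ _ hy, mul_ofReal_cpow _ _ hY]
  simp only [norm_mul, norm_div, norm_pow, norm_cpow_eq_rpow_re_of_pos hy,
    norm_cpow_eq_rpow_re_of_pos hY, norm_real, Real.norm_of_nonneg hx.le,
    Real.norm_of_nonneg hX.le]
  gcongr

/-- The general term of the series of `hkKernel`. -/
noncomputable def hkKernelTerm (κ ρ Υ γ₁ γ₂ ϖ₁ ϖ₂ : ℂ) (X Y : ℝ) (p : ℕ × ℕ) : ℂ :=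
  (X : ℂ) ^ (κ - 1) * (Y : ℂ) ^ (ρ - 1)
    * hkMittagLefflerTerm κ ρ Υ γ₁ γ₂ ((γ₁ + 1) / 2) γ₂ (ϖ₁ * X) (ϖ₂ * Y) p.1 p.2

lemma hasSum_hkKernel {κ ρ Υ γ₁ γ₂ : ℂ} (hκ : 0 < κ.re) (hρ : 0 < ρ.re)
    (hΥ : 0 < Υ.re) (h₁ : 0 < γ₁.re) (h₂ : 0 < γ₂.re) (ϖ₁ ϖ₂ : ℂ) (X Y : ℝ) :
    HasSum (hkKernelTerm κ ρ Υ γ₁ γ₂ ϖ₁ ϖ₂ X Y) (hkKernel κ ρ Υ γ₁ γ₂ ϖ₁ ϖ₂ X Y) := by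
  have h := summable_hkMittagLefflerTerm hκ hρ hΥ h₁ h₂ (ϖ₁ * X) (ϖ₂ * Y)
  rw [hkKernel, hkMittagLeffler, ← h.tsum_prod]
  exact h.hasSum.mul_left _

lemma summable_norm_hkKernelTerm {κ ρ Υ γ₁ γ₂ : ℂ} (hκ : 0 < κ.re) (hρ : 0 < ρ.re)
    (hΥ : 0 < Υ.re) (h₁ : 0 < γ₁.re) (h₂ : 0 < γ₂.re) (ϖ₁ ϖ₂ : ℂ) (X Y : ℝ) :
    Summable fun p => ‖hkKernelTerm κ ρ Υ γ₁ γ₂ ϖ₁ ϖ₂ X Y p‖ :=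
  (hasSum_hkKernel hκ hρ hΥ h₁ h₂ ϖ₁ ϖ₂ X Y).summable.norm

lemma hkKernelTerm_eq (κ ρ Υ : ℂ) {γ₁ γ₂ : ℂ} (h₁ : 0 < γ₁.re) (h₂ : 0 < γ₂.re) (ϖ₁ ϖ₂ : ℂ)
    {X Y : ℝ} (hX : 0 < X) (hY : 0 < Y) (p : ℕ × ℕ) :
    hkKernelTerm κ ρ Υ γ₁ γ₂ ϖ₁ ϖ₂ X Y p
      = hkCoeff γ₁ γ₂ p.1 p.2 * (ϖ₁ ^ p.1 * (ϖ₂ ^ Υ) ^ p.2)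
        * (rlKernel (κ + p.1) X * rlKernel (ρ + Υ * p.2) Y) := by
  rw [hkKernelTerm, hkMittagLefflerTerm_eq κ ρ Υ h₁ h₂, mul_ofReal_cpow _ _ hY,
    rlKernel_add _ _ hX, rlKernel_add _ _ hY, cpow_natCast, cpow_mul_nat, mul_pow, mul_pow]
  ring

/-! ### Termwise integration and regrouping -/

/-- Dominated convergence for a series dominated by a summable sequence times an integrable
function. -/
lemma integrable_and_hasSum_integral_of_norm_le_mul {ι α : Type*} [Countable ι]
    [MeasurableSpace α] {μ : Measure α} {F : ι → α → ℂ} {f : α → ℂ} {u : ι → ℝ} {H : α → ℝ}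
    (hF : ∀ i, AEStronglyMeasurable (F i) μ) (hle : ∀ i, ∀ᵐ a ∂μ, ‖F i a‖ ≤ u i * H a)
    (hu : Summable u) (hH : Integrable H μ) (hsum : ∀ᵐ a ∂μ, HasSum (fun i => F i a) (f a)) :
    Integrable f μ ∧ HasSum (fun i => ∫ a, F i a ∂μ) (∫ a, f a ∂μ) := by
  constructor
  · refine Integrable.mono' (hH.const_mul (∑' i, u i)) ?_ ?_
    · exact aestronglyMeasurable_of_tendsto_ae atTop
        (f := fun (s : Finset ι) a => ∑ i ∈ s, F i a)
        (fun s => by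
          have := Finset.aestronglyMeasurable_sum s (fun i _ => hF i)
          exact this.congr (Eventually.of_forall fun a => by simp)) hsum
    · filter_upwards [hsum, ae_all_iff.2 hle] with a ha hla
      rw [← ha.tsum_eq, ← tsum_mul_right]
      exact tsum_of_norm_bounded (hu.mul_right _).hasSum hla
  · refine hasSum_integral_of_dominated_convergence (fun i a => u i * H a) hF hle
      (Eventually.of_forall fun a => hu.mul_right _) ?_ hsum
    simp only [tsum_mul_right]
    exact hH.const_mul _

/-- Regrouping of a double Cauchy product along antidiagonals. -/
lemma HasSum.sum_antidiagonal_antidiagonal {f : (ℕ × ℕ) × (ℕ × ℕ) → ℂ} {a : ℂ}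
    (h : HasSum f a) :
    HasSum (fun c : ℕ × ℕ => ∑ i ∈ antidiagonal c.1, ∑ j ∈ antidiagonal c.2,
      f ((i.1, j.1), (i.2, j.2))) a := by
  refine Eq.mp (congrArg (fun g => HasSum g a) (funext fun c => ?_))
    (h.tsum_fiberwise (fun p : (ℕ × ℕ) × (ℕ × ℕ) => p.1 + p.2))
  rw [← sum_product']
  -- Antidiagonals pair indices as `((s, s'), (r, r'))`, the product of series as `((s, r), (s',
  -- r'))`.
  let e : (ℕ × ℕ) × (ℕ × ℕ) ≃ (ℕ × ℕ) × (ℕ × ℕ) := Equiv.prodProdProdComm ℕ ℕ ℕ ℕ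
  have hset : (fun p : (ℕ × ℕ) × (ℕ × ℕ) => p.1 + p.2) ⁻¹' {c}
      = (((antidiagonal c.1 ×ˢ antidiagonal c.2).map e.toEmbedding :
          Finset ((ℕ × ℕ) × (ℕ × ℕ))) : Set _) := by
    ext ⟨⟨s, r⟩, ⟨s', r'⟩⟩
    simp [e, Prod.ext_iff]
  rw [hset, Finset.tsum_subtype', sum_map]
  rfl

lemma integral_hkKernelTerm_mul {κ ρ σ η Υ γ₁ γ₂ μ₁ μ₂ : ℂ} (hκ : 0 < κ.re) (hρ : 0 < ρ.re)
    (hσ : 0 < σ.re) (hη : 0 < η.re) (hΥ : 0 < Υ.re) (hγ₁ : 0 < γ₁.re) (hγ₂ : 0 < γ₂.re)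
    (hμ₁ : 0 < μ₁.re) (hμ₂ : 0 < μ₂.re) (ϖ₁ ϖ₂ : ℂ) {X Y : ℝ} (hX : 0 < X) (hY : 0 < Y)
    (p q : ℕ × ℕ) :
    ∫ z in Set.Ioo 0 X ×ˢ Set.Ioo 0 Y, hkKernelTerm κ ρ Υ γ₁ γ₂ ϖ₁ ϖ₂ (X - z.1) (Y - z.2) p
        * hkKernelTerm σ η Υ μ₁ μ₂ ϖ₁ ϖ₂ z.1 z.2 q
      = hkCoeff γ₁ γ₂ p.1 p.2 * hkCoeff μ₁ μ₂ q.1 q.2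
        * ((ϖ₁ ^ (p.1 + q.1) * (ϖ₂ ^ Υ) ^ (p.2 + q.2))
          * (rlKernel (κ + σ + (p.1 + q.1 : ℕ)) X
            * rlKernel (ρ + η + Υ * (p.2 + q.2 : ℕ)) Y)) := by
  have hre : ∀ {a b : ℂ} (n : ℕ), 0 < a.re → 0 < b.re → 0 < (a + b * n).re := fun n ha hb => by
    simp only [add_re, mul_re, natCast_re, natCast_im, mul_zero, sub_zero]
    positivity
  have hre1 : ∀ {a : ℂ} (n : ℕ), 0 < a.re → 0 < (a + n).re := fun n ha => by
    simp only [add_re, natCast_re]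
    positivity
  have h : Set.EqOn (fun z : ℝ × ℝ => hkKernelTerm κ ρ Υ γ₁ γ₂ ϖ₁ ϖ₂ (X - z.1) (Y - z.2) p
        * hkKernelTerm σ η Υ μ₁ μ₂ ϖ₁ ϖ₂ z.1 z.2 q)
      (fun z => hkCoeff γ₁ γ₂ p.1 p.2 * hkCoeff μ₁ μ₂ q.1 q.2
        * (ϖ₁ ^ (p.1 + q.1) * (ϖ₂ ^ Υ) ^ (p.2 + q.2))
        * ((rlKernel (κ + p.1) (X - z.1) * rlKernel (σ + q.1) z.1)
          * (rlKernel (ρ + Υ * p.2) (Y - z.2) * rlKernel (η + Υ * q.2) z.2)))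
      (Set.Ioo 0 X ×ˢ Set.Ioo 0 Y) := fun z hz => by
    beta_reduce
    rw [hkKernelTerm_eq κ ρ Υ hγ₁ hγ₂ ϖ₁ ϖ₂ (sub_pos.2 hz.1.2) (sub_pos.2 hz.2.2),
      hkKernelTerm_eq σ η Υ hμ₁ hμ₂ ϖ₁ ϖ₂ hz.1.1 hz.2.1]
    ring
  rw [setIntegral_congr_fun (measurableSet_Ioo.prod measurableSet_Ioo) h, integral_const_mul,
    Measure.volume_eq_prod,
    setIntegral_prod_mul (fun t => rlKernel (κ + p.1) (X - t) * rlKernel (σ + q.1) t)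
      (fun ω => rlKernel (ρ + Υ * p.2) (Y - ω) * rlKernel (η + Υ * q.2) ω),
    integral_rlKernel_mul (hre1 _ hκ) (hre1 _ hσ) hX,
    integral_rlKernel_mul (hre _ hρ hΥ) (hre _ hη hΥ) hY, mul_assoc]
  push_cast
  rw [show κ + p.1 + (σ + q.1) = κ + σ + (p.1 + q.1) by ring,
    show ρ + Υ * p.2 + (η + Υ * q.2) = ρ + η + Υ * (p.2 + q.2) by ring]

lemma measurable_hkKernelTerm (κ ρ Υ γ₁ γ₂ ϖ₁ ϖ₂ : ℂ) (p : ℕ × ℕ) :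
    Measurable fun z : ℝ × ℝ => hkKernelTerm κ ρ Υ γ₁ γ₂ ϖ₁ ϖ₂ z.1 z.2 p := by
  unfold hkKernelTerm hkMittagLefflerTerm
  fun_prop

lemma integrableOn_and_hasSum_integral_hkKernel_mul {κ ρ σ η Υ γ₁ γ₂ μ₁ μ₂ : ℂ}
    (hκ : 0 < κ.re) (hρ : 0 < ρ.re) (hσ : 0 < σ.re) (hη : 0 < η.re) (hΥ : 0 < Υ.re)
    (hγ₁ : 0 < γ₁.re) (hγ₂ : 0 < γ₂.re) (hμ₁ : 0 < μ₁.re) (hμ₂ : 0 < μ₂.re) (ϖ₁ ϖ₂ : ℂ)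
    {X Y : ℝ} (hX : 0 < X) (hY : 0 < Y) :
    IntegrableOn (fun z : ℝ × ℝ =>
        hkKernel κ ρ Υ γ₁ γ₂ ϖ₁ ϖ₂ (X - z.1) (Y - z.2) * hkKernel σ η Υ μ₁ μ₂ ϖ₁ ϖ₂ z.1 z.2)
      (Set.Ioo 0 X ×ˢ Set.Ioo 0 Y) ∧
    HasSum (fun i : (ℕ × ℕ) × (ℕ × ℕ) => ∫ z in Set.Ioo 0 X ×ˢ Set.Ioo 0 Y,
        hkKernelTerm κ ρ Υ γ₁ γ₂ ϖ₁ ϖ₂ (X - z.1) (Y - z.2) i.1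
          * hkKernelTerm σ η Υ μ₁ μ₂ ϖ₁ ϖ₂ z.1 z.2 i.2)
      (∫ z in Set.Ioo 0 X ×ˢ Set.Ioo 0 Y,
        hkKernel κ ρ Υ γ₁ γ₂ ϖ₁ ϖ₂ (X - z.1) (Y - z.2)
          * hkKernel σ η Υ μ₁ μ₂ ϖ₁ ϖ₂ z.1 z.2) := by
  have hmeas : MeasurableSet (Set.Ioo 0 X ×ˢ Set.Ioo 0 Y) :=
    measurableSet_Ioo.prod measurableSet_Ioo
  have hS₁ := (summable_hkMittagLefflerTerm hκ hρ hΥ hγ₁ hγ₂ (ϖ₁ * X) (ϖ₂ * Y)).norm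
  have hS₂ := (summable_hkMittagLefflerTerm hσ hη hΥ hμ₁ hμ₂ (ϖ₁ * X) (ϖ₂ * Y)).norm
  -- The weight keeps only the endpoint singularities of the powers, integrable because all four
  -- exponents have real part above -1.
  have hH : IntegrableOn (fun z : ℝ × ℝ =>
      ‖((X - z.1 : ℝ) : ℂ) ^ (κ - 1) * (z.1 : ℂ) ^ (σ - 1)‖
        * ‖((Y - z.2 : ℝ) : ℂ) ^ (ρ - 1) * (z.2 : ℂ) ^ (η - 1)‖)
      (Set.Ioo 0 X ×ˢ Set.Ioo 0 Y) := by
    rw [IntegrableOn, Measure.volume_eq_prod, ← Measure.prod_restrict]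
    exact (integrableOn_rlKernel_mul hκ hσ hX).norm.mul_prod
      (integrableOn_rlKernel_mul hρ hη hY).norm
  refine integrable_and_hasSum_integral_of_norm_le_mul (fun i => ?_) (fun i => ?_)
    (hS₁.mul_of_nonneg hS₂ (fun _ => norm_nonneg _) (fun _ => norm_nonneg _)) hH ?_
  · have h := (measurable_hkKernelTerm κ ρ Υ γ₁ γ₂ ϖ₁ ϖ₂ i.1).comp
      (show Measurable fun z : ℝ × ℝ => (X - z.1, Y - z.2) by fun_prop)
    exact (h.mul (measurable_hkKernelTerm σ η Υ μ₁ μ₂ ϖ₁ ϖ₂ i.2)).aestronglyMeasurable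
  · refine (ae_restrict_iff' hmeas).2 (Eventually.of_forall fun z hz => ?_)
    have h1 := norm_hkMittagLefflerTerm_mono κ ρ γ₁ γ₂ ((γ₁ + 1) / 2) γ₂ ϖ₁ ϖ₂ hΥ
      (sub_pos.2 hz.1.2) (sub_le_self X hz.1.1.le) (sub_pos.2 hz.2.2) (sub_le_self Y hz.2.1.le)
      i.1.1 i.1.2
    have h2 := norm_hkMittagLefflerTerm_mono σ η μ₁ μ₂ ((μ₁ + 1) / 2) μ₂ ϖ₁ ϖ₂ hΥ
      hz.1.1 hz.1.2.le hz.2.1 hz.2.2.le i.2.1 i.2.2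
    refine le_trans (le_of_eq ?_)
      (mul_le_mul_of_nonneg_right (mul_le_mul h1 h2 (norm_nonneg _) (norm_nonneg _))
        (by positivity))
    simp only [hkKernelTerm, norm_mul]
    ring
  · refine Eventually.of_forall fun z => ?_
    exact (hasSum_hkKernel hκ hρ hΥ hγ₁ hγ₂ ϖ₁ ϖ₂ (X - z.1) (Y - z.2)).mul
      (hasSum_hkKernel hσ hη hΥ hμ₁ hμ₂ ϖ₁ ϖ₂ z.1 z.2)
      (summable_mul_of_summable_norm
        (summable_norm_hkKernelTerm hκ hρ hΥ hγ₁ hγ₂ ϖ₁ ϖ₂ (X - z.1) (Y - z.2))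
        (summable_norm_hkKernelTerm hσ hη hΥ hμ₁ hμ₂ ϖ₁ ϖ₂ z.1 z.2))

lemma setIntegral_hkKernel_mul {κ ρ σ η Υ γ₁ γ₂ μ₁ μ₂ : ℂ}
    (hκ : 0 < κ.re) (hρ : 0 < ρ.re) (hσ : 0 < σ.re) (hη : 0 < η.re) (hΥ : 0 < Υ.re)
    (hγ₁ : 0 < γ₁.re) (hγ₂ : 0 < γ₂.re) (hμ₁ : 0 < μ₁.re) (hμ₂ : 0 < μ₂.re) (ϖ₁ ϖ₂ : ℂ)
    {X Y : ℝ} (hX : 0 < X) (hY : 0 < Y) :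
    ∫ z in Set.Ioo 0 X ×ˢ Set.Ioo 0 Y,
        hkKernel κ ρ Υ γ₁ γ₂ ϖ₁ ϖ₂ (X - z.1) (Y - z.2) * hkKernel σ η Υ μ₁ μ₂ ϖ₁ ϖ₂ z.1 z.2
      = hkKernel (κ + σ) (ρ + η) Υ (γ₁ + μ₁) (γ₂ + μ₂) ϖ₁ ϖ₂ X Y := by
  have h₁ : 0 < (γ₁ + μ₁).re := add_pos hγ₁ hμ₁
  have h₂ : 0 < (γ₂ + μ₂).re := add_pos hγ₂ hμ₂
  have hL := (integrableOn_and_hasSum_integral_hkKernel_mul hκ hρ hσ hη hΥ hγ₁ hγ₂ hμ₁ hμ₂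
    ϖ₁ ϖ₂ hX hY).2.sum_antidiagonal_antidiagonal
  have hR := hasSum_hkKernel (κ := κ + σ) (ρ := ρ + η) (add_pos hκ hσ) (add_pos hρ hη)
    hΥ h₁ h₂ ϖ₁ ϖ₂ X Y
  refine hL.unique (Eq.mp (congrArg (fun g => HasSum g _) (funext fun c => ?_)) hR)
  rw [hkKernelTerm_eq _ _ _ h₁ h₂ ϖ₁ ϖ₂ hX hY, ← sum_antidiagonal_hkCoeff, mul_assoc, sum_mul]
  refine sum_congr rfl fun i hi => ?_
  rw [sum_mul]
  refine sum_congr rfl fun j hj => ?_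
  rw [integral_hkKernelTerm_mul hκ hρ hσ hη hΥ hγ₁ hγ₂ hμ₁ hμ₂ ϖ₁ ϖ₂ hX hY,
    mem_antidiagonal.1 hi, mem_antidiagonal.1 hj]

theorem mainTheorem7
    (κ ρ σ η Υ γ₁ γ₂ μ₁ μ₂ ϖ₁ ϖ₂ : ℂ)
    (hκ : 0 < κ.re) (hρ : 0 < ρ.re) (hσ : 0 < σ.re) (hη : 0 < η.re) (hΥ : 0 < Υ.re)
    (hγ₁ : 0 < γ₁.re) (hγ₂ : 0 < γ₂.re) (hμ₁ : 0 < μ₁.re) (hμ₂ : 0 < μ₂.re)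
    (X Y : ℝ) (hX : 0 < X) (hY : 0 < Y) :
    -- the three double series converge absolutely at every point
    (∀ x y : ℂ, Summable (fun p : ℕ × ℕ =>
      hkMittagLefflerTerm κ ρ Υ γ₁ γ₂ ((γ₁ + 1) / 2) γ₂ x y p.1 p.2)) ∧
    (∀ x y : ℂ, Summable (fun p : ℕ × ℕ =>
      hkMittagLefflerTerm σ η Υ μ₁ μ₂ ((μ₁ + 1) / 2) μ₂ x y p.1 p.2)) ∧
    (∀ x y : ℂ, Summable (fun p : ℕ × ℕ =>
      hkMittagLefflerTerm (κ + σ) (ρ + η) Υ (γ₁ + μ₁) (γ₂ + μ₂) ((γ₁ + μ₁ + 1) / 2) (γ₂ + μ₂)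
        x y p.1 p.2)) ∧
    -- the double integral converges absolutely
    MeasureTheory.IntegrableOn (fun q : ℝ × ℝ =>
        hkKernel κ ρ Υ γ₁ γ₂ ϖ₁ ϖ₂ (X - q.1) (Y - q.2) * hkKernel σ η Υ μ₁ μ₂ ϖ₁ ϖ₂ q.1 q.2)
      (Set.Ioo 0 X ×ˢ Set.Ioo 0 Y) ∧
    -- the transformation formula
    ∫ t in (0 : ℝ)..X, ∫ ω in (0 : ℝ)..Y,
        hkKernel κ ρ Υ γ₁ γ₂ ϖ₁ ϖ₂ (X - t) (Y - ω) * hkKernel σ η Υ μ₁ μ₂ ϖ₁ ϖ₂ t ω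
      = hkKernel (κ + σ) (ρ + η) Υ (γ₁ + μ₁) (γ₂ + μ₂) ϖ₁ ϖ₂ X Y := by

  have hint := (integrableOn_and_hasSum_integral_hkKernel_mul hκ hρ hσ hη hΥ hγ₁ hγ₂ hμ₁ hμ₂
    ϖ₁ ϖ₂ hX hY).1
  refine ⟨summable_hkMittagLefflerTerm hκ hρ hΥ hγ₁ hγ₂,
    summable_hkMittagLefflerTerm hσ hη hΥ hμ₁ hμ₂,
    summable_hkMittagLefflerTerm (add_pos hκ hσ) (add_pos hρ hη) hΥ (add_pos hγ₁ hμ₁)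
      (add_pos hγ₂ hμ₂), hint, ?_⟩
  rw [← setIntegral_hkKernel_mul hκ hρ hσ hη hΥ hγ₁ hγ₂ hμ₁ hμ₂ ϖ₁ ϖ₂ hX hY]
  -- Absolute integrability permits Fubini, which passes from the rectangle to the iterated
  -- integral.
  rw [Measure.volume_eq_prod] at hint ⊢
  rw [setIntegral_prod _ hint]
  simp only [intervalIntegral.integral_of_le hX.le, intervalIntegral.integral_of_le hY.le,
    integral_Ioc_eq_integral_Ioo]
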